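/- Equip $\mathbb{R}^2$ with the $L_p$-metric, $1\le p\le\infty$, and write $|\overline{ab}|_p$ for the $L_p$-distance of $a$ and $b$. Let the highway $\mathcal H$ be the $x$-axis, on which one moves with speed $v_{\mathcal H}$, $1<v_{\mathcal H}\le\infty$; off $\mathcal H$ the speed is $1$. The traveling time along a continuous curve is the $L_p$-length of its part off $\mathcal H$ plus $1/v_{\mathcal H}$ times the length of its part on $\mathcal H$ (with $1/\infty=0$), and a shortest time-path between two points is a continuous curve joining them whose traveling time is minimum among all such curves. The walking region $\mathrm{WR}_p(q)$ is the set of points $q'$ for which some shortest time-path between $q'$ and $q$ does not meet $\mathcal H$. Let $\alpha=\pi/4$ if $p=\infty$; let $\alpha=0$ if $p=1$, or if $p<\infty$ and $v_{\mathcal H}=\infty$; and otherwise let $$\alpha=\arcsin\frac{v_{\mathcal H}^{1/(1-p)}}{\sqrt{v_{\mathcal H}^{2/(1-p)}+\bigl(1-v_{\mathcal H}^{p/(1-p)}\bigr)^{2/p}}}.$$ For a point $z=(x_z,y_z)$ with $y_z\ge0$ put $z^{\pm}_{\mathcal H}=(x_z\pm y_z\tan\alpha,\,0)$. **Lemma.**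 Let $q=(x_q,y_q)$ with $y_q>0$. Let the right discriminating curve $R$ of $q$ be the set of all $q'=(x',y')$ with $y'\ge0$, $x'\ge x_q+y_q\tan\alpha$ and $$|\overline{qq'}|_p=|\overline{q\,q^{+}_{\mathcal H}}|_p+|\overline{q'\,q'^{-}_{\mathcal H}}|_p+\frac1{v_{\mathcal H}}\,|\overline{q^{+}_{\mathcal H}\,q'^{-}_{\mathcal H}}|_p,$$ and let the left discriminating curve $L$ be the mirror image of $R$ in the line $x=x_q$. Then $\mathrm{WR}_p(q)$ is the region above $\mathcal H$ bounded by $L$ and $R$. That is: 1. There is a continuous function $r:[0,\infty)\to\mathbb{R}$ with $R=\{(r(y),y):y\ge0\}$, $L=\{(2x_q-r(y),y):y\ge0\}$ and $\mathrm{WR}_p(q)=\{(x,y): y>0,\ 2x_q-r(y)\le x\le r(y)\}$. 2. The topological boundary of $\mathrm{WR}_p(q)$ in the plane is the union of $L$, $R$ and the segment of $\mathcal H$ from $q^-_{\mathcal H}$ to $q^+_{\mathcal H}$. 3. For $p=\infty$ the curves are linear: $R=\{(x,y):y\ge0,\ y=x-x_q-y_q\}$ and $L=\{(x,y):y\ge0,\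 y=x_q-y_q-x\}$. -/

import Mathlib

open Set
open scoped ENNReal

noncomputable section

namespace Highway

/-- The plane `ℝ²` with the `L_p` metric; `z 0` and `z 1` are the coordinates `x` and `y`. -/
abbrev Plane (p : ℝ≥0∞) : Type := PiLp p (fun _ : Fin 2 => ℝ)

/-- The point with coordinates `(x, y)`. -/
def pt (p : ℝ≥0∞) (x y : ℝ) : Plane p := WithLp.toLp p ![x, y]

/-- The highway: the `x`-axis. -/
def road (p : ℝ≥0∞) : Set (Plane p) := {z | z 1 = 0}

open Classical in
/-- The reciprocal of the greatest speed that is available somewhere on the set `S`, when the speed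
is `v > 1` on the highway and `1` off the highway (`v = ∞` gives `0`). -/
def slowness (p v : ℝ≥0∞) (S : Set (Plane p)) : ℝ≥0∞ :=
  if Disjoint S (road p) then 1 else v⁻¹

/-- The traveling time along a continuous curve `γ`, that is the integral of `1 / speed` with
respect to the `L_p` arc length of `γ`. It is written as the supremum, over all finite partitions
`u 0 ≤ u 1 ≤ ⋯ ≤ u n` of the parameter interval, of the sums of the chord lengths, each divided by
the greatest speed available on its piece of the curve. As `1 / speed` is lower semicontinuous, this
supremum of lower sums is the integral: the length of the part of `γ` off the highway plus `1 / v`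
times the length of the part on the highway. -/
def travelTime {p : ℝ≥0∞} [Fact (1 ≤ p)] (v : ℝ≥0∞) {a b : Plane p} (γ : Path a b) : ℝ≥0∞ :=
  ⨆ (n : ℕ) (u : ℕ → unitInterval) (_ : Monotone u),
    ∑ i ∈ Finset.range n,
      slowness p v (γ '' Icc (u i) (u (i + 1))) * edist (γ (u i)) (γ (u (i + 1)))

/-- `γ` is a shortest time-path: no continuous curve with the same end points is faster. -/
def IsShortestTimePath {p : ℝ≥0∞} [Fact (1 ≤ p)] (v : ℝ≥0∞) {a b : Plane p} (γ : Path a b) :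
    Prop :=
  ∀ γ' : Path a b, travelTime v γ ≤ travelTime v γ'

/-- `γ` enters the highway: it has a point on the highway. -/
def EntersRoad {p : ℝ≥0∞} {a b : Plane p} (γ : Path a b) : Prop :=
  (range γ ∩ road p).Nonempty

/-- The walking region of `q`: the points from which some shortest time-path to `q` does not enter
the highway. -/
def walkingRegion {p : ℝ≥0∞} [Fact (1 ≤ p)] (v : ℝ≥0∞) (q : Plane p) : Set (Plane p) :=
  {q' | ∃ γ : Path q' q, IsShortestTimePath v γ ∧ ¬ EntersRoad γ}

open Classical in
/-- The incidence angle `α(p, v)`. -/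
def angle (p v : ℝ≥0∞) : ℝ :=
  if p = ∞ then Real.pi / 4
  else if p = 1 ∨ v = ∞ then 0
  else
    let s : ℝ := p.toReal
    let w : ℝ := v.toReal
    Real.arcsin (w ^ (1 / (1 - s)) /
      Real.sqrt (w ^ (2 / (1 - s)) + (1 - w ^ (s / (1 - s))) ^ (2 / s)))

/-- The point `z⁺` of the highway, `(x_z + y_z tan α, 0)`. -/
def footRight {p : ℝ≥0∞} (v : ℝ≥0∞) (z : Plane p) : Plane p :=
  pt p (z 0 + z 1 * Real.tan (angle p v)) 0

/-- The point `z⁻` of the highway, `(x_z - y_z tan α, 0)`. -/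
def footLeft {p : ℝ≥0∞} (v : ℝ≥0∞) (z : Plane p) : Plane p :=
  pt p (z 0 - z 1 * Real.tan (angle p v)) 0

/-- The right discriminating curve of `q`; it lies in the closed upper half-plane, where the feet
of a point are defined. -/
def rightCurve {p : ℝ≥0∞} [Fact (1 ≤ p)] (v : ℝ≥0∞) (q : Plane p) : Set (Plane p) :=
  {q' | 0 ≤ q' 1 ∧ q 0 + q 1 * Real.tan (angle p v) ≤ q' 0 ∧
    dist q q' = dist q (footRight v q) + dist q' (footLeft v q') +
      (v⁻¹).toReal * dist (footRight v q) (footLeft v q')}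

/-- The reflection in the vertical line through `q`. -/
def mirror {p : ℝ≥0∞} (q z : Plane p) : Plane p := pt p (2 * q 0 - z 0) (z 1)

/-- The left discriminating curve of `q`: the mirror image of the right one in the vertical line
through `q`. -/
def leftCurve {p : ℝ≥0∞} [Fact (1 ≤ p)] (v : ℝ≥0∞) (q : Plane p) : Set (Plane p) :=
  mirror q '' rightCurve v q

end Highway

end

/-! ### Coordinates and the `L_p` norm of the plane. -/

namespace Highway

variable {p : ℝ≥0∞}

/-! Put `k = 1 / v` and `t = tan α`. The slope `t` minimises `‖(x, 1)‖ - k x`, the cost of walking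
to the road from height `1` less the riding it saves (`isIncidence_angle`); let `c` be the minimum.
For points at heights `b`, `y` and horizontal distance `D`, homogeneity and the triangle inequality
show that every trip over the road costs at least `(b + y) c + k D`, with equality for legs of slope
`t` once `D ≥ t (b + y)`.

Walking costs `‖(D, y - b)‖`. The function `x ↦ ‖(x, y - b)‖ - k x` is convex with a minimum at `t
|y - b| ≤ t (b + y)`, so beyond `t (b + y)` it increases strictly and takes the value `(b + y) c`
exactly once, at `ρ y` (`exists_continuous_root`). This root is the discriminating curve
(`eq_root`). Walking is optimal up to `ρ y` (`direct_le_detour`) and strictly worse beyond it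
(`detour_lt_direct`).

Curves reduce to these norms because a curve that meets the road costs at least the detour through
its first and last road points (`exists_detour_le_travelTime`), while a polygonal path costs at most
its detour (`travelTime_polygonalPath_le`). -/

@[simp] lemma pt_zero (x y : ℝ) : pt p x y 0 = x := rfl

@[simp] lemma pt_one (x y : ℝ) : pt p x y 1 = y := rfl

lemma plane_ext {z w : Plane p} (h0 : z 0 = w 0) (h1 : z 1 = w 1) : z = w := by
  ext i
  fin_cases i
  · exact h0
  · exact h1

lemma pt_coords (z : Plane p) : pt p (z 0) (z 1) = z := plane_ext rfl rfl

lemma continuous_pt : Continuous fun z : ℝ × ℝ => pt p z.1 z.2 := by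
  unfold pt
  fun_prop

lemma norm_pt_top (x y : ℝ) : ‖pt ∞ x y‖ = max |x| |y| := by
  rw [PiLp.norm_eq_ciSup]
  apply le_antisymm
  · apply ciSup_le
    intro i
    fin_cases i
    · exact le_max_left _ _
    · exact le_max_right _ _
  · have hb : BddAbove (range fun i => ‖pt ∞ x y i‖) := (finite_range _).bddAbove
    exact max_le (le_ciSup hb 0) (le_ciSup hb 1)

lemma norm_pt_of_ne_top [hp : Fact (1 ≤ p)] (h : p ≠ ∞) (x y : ℝ) :
    ‖pt p x y‖ = (|x| ^ p.toReal + |y| ^ p.toReal) ^ (1 / p.toReal) := by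
  have h0 : 0 < p.toReal :=
    ENNReal.toReal_pos (zero_lt_one.trans_le hp.out).ne' h
  rw [PiLp.norm_eq_sum h0]
  simp

variable [hp : Fact (1 ≤ p)]

lemma one_le_toReal (h : p ≠ ∞) : 1 ≤ p.toReal := by
  simpa using ENNReal.toReal_mono h hp.out

lemma norm_pt_le_norm_pt {x y x' y' : ℝ} (hx : |x| ≤ |x'|) (hy : |y| ≤ |y'|) :
    ‖pt p x y‖ ≤ ‖pt p x' y'‖ := by
  by_cases h : p = ∞
  · subst h
    rw [norm_pt_top, norm_pt_top]
    exact max_le_max hx hy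
  · have h1 := one_le_toReal h
    rw [norm_pt_of_ne_top h, norm_pt_of_ne_top h]
    gcongr

lemma norm_pt_congr {x y x' y' : ℝ} (hx : |x| = |x'|) (hy : |y| = |y'|) :
    ‖pt p x y‖ = ‖pt p x' y'‖ :=
  le_antisymm (norm_pt_le_norm_pt hx.le hy.le) (norm_pt_le_norm_pt hx.ge hy.ge)

lemma dist_eq_norm_pt (z w : Plane p) : dist z w = ‖pt p (z 0 - w 0) (z 1 - w 1)‖ := by
  rw [dist_eq_norm]
  exact congrArg _ (plane_ext rfl rfl)

lemma norm_pt_smul (a x y : ℝ) : ‖pt p (a * x) (a * y)‖ = |a| * ‖pt p x y‖ := by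
  rw [← Real.norm_eq_abs, ← norm_smul]
  congr 1
  exact plane_ext rfl rfl

lemma norm_pt_mul_left (t : ℝ) {s : ℝ} (hs : 0 ≤ s) : ‖pt p (t * s) s‖ = s * ‖pt p t 1‖ := by
  have e := norm_pt_smul (p := p) s t 1
  rwa [mul_one, abs_of_nonneg hs, mul_comm s t] at e

lemma norm_pt_add_le (x y x' y' : ℝ) :
    ‖pt p (x + x') (y + y')‖ ≤ ‖pt p x y‖ + ‖pt p x' y'‖ := by
  refine le_trans (le_of_eq ?_) (norm_add_le _ _)
  congr 1
  exact plane_ext rfl rfl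

lemma norm_pt_zero_right (x : ℝ) : ‖pt p x 0‖ = |x| := by
  by_cases h : p = ∞
  · subst h
    simp [norm_pt_top]
  · have h1 := one_le_toReal h
    rw [norm_pt_of_ne_top h, abs_zero, Real.zero_rpow (by linarith), add_zero, one_div,
      Real.rpow_rpow_inv (abs_nonneg _) (by linarith)]

lemma norm_pt_zero_left (y : ℝ) : ‖pt p 0 y‖ = |y| := by
  by_cases h : p = ∞
  · subst h
    simp [norm_pt_top]
  · have h1 := one_le_toReal h
    rw [norm_pt_of_ne_top h, abs_zero, Real.zero_rpow (by linarith), zero_add, one_div,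
      Real.rpow_rpow_inv (abs_nonneg _) (by linarith)]

lemma abs_le_norm_pt (x y : ℝ) : |x| ≤ ‖pt p x y‖ := by
  rw [← norm_pt_zero_right (p := p)]
  exact norm_pt_le_norm_pt le_rfl (by simp)

lemma continuous_norm_pt : Continuous fun z : ℝ × ℝ => ‖pt p z.1 z.2‖ :=
  continuous_pt.norm

lemma convexOn_norm_pt_sub (s k : ℝ) : ConvexOn ℝ univ fun x => ‖pt p x s‖ - k * x := by
  refine ⟨convex_univ, fun x _ y _ a b ha hb hab => ?_⟩
  have h := norm_pt_add_le (p := p) (a * x) (a * s) (b * y) (b * s)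
  rw [norm_pt_smul, norm_pt_smul, abs_of_nonneg ha, abs_of_nonneg hb, ← add_mul, hab,
    one_mul] at h
  simp only [smul_eq_mul]
  linarith

/-! ### Optimal incidence slopes. -/

/-- The slope `t` is an optimal incidence slope for slowness `k`: the cost of reaching the highway
from height `1`, minus the saving along the highway, is least at the slope `t`, and strictly larger
at greater slopes. -/
structure IsIncidence (p : ℝ≥0∞) [Fact (1 ≤ p)] (k t : ℝ) : Prop where
  nonneg : 0 ≤ k
  lt_one : k < 1
  slope_nonneg : 0 ≤ t
  le : ∀ x, ‖pt p t 1‖ - k * t ≤ ‖pt p x 1‖ - k * x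
  lt : ∀ x, t < x → ‖pt p t 1‖ - k * t < ‖pt p x 1‖ - k * x
  -- With a free highway the riding term vanishes from the curve equation, and `eq_root` has to
  -- exclude crossed feet from the slope alone.
  slope_eq : k = 0 → t = 0 ∨ p = ∞ ∧ t = 1

/-- The cost `max |x| 1 - k x` does not increase up to `1` and has slope `1 - k > 0` afterwards. For
`k = 0` every point of `[-1, 1]` is a minimiser and `1` is the largest, so strictness can be asked
only to the right. -/
lemma isIncidence_top {k : ℝ} (h0 : 0 ≤ k) (h1 : k < 1) : IsIncidence ∞ k 1 where
  nonneg := h0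
  lt_one := h1
  slope_nonneg := zero_le_one
  le x := by
    simp only [norm_pt_top, abs_one, max_self]
    rcases le_total x 1 with h | h
    · nlinarith [le_max_right |x| 1]
    · nlinarith [le_max_left |x| 1, le_abs_self x]
  lt x h := by
    simp only [norm_pt_top, abs_one, max_self]
    nlinarith [le_max_left |x| 1, le_abs_self x]
  slope_eq _ := Or.inr ⟨rfl, rfl⟩

lemma isIncidence_one {k : ℝ} (h0 : 0 ≤ k) (h1 : k < 1) : IsIncidence 1 k 0 where
  nonneg := h0
  lt_one := h1
  slope_nonneg := le_rfl
  le x := by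
    simp only [norm_pt_of_ne_top ENNReal.one_ne_top]
    norm_num
    nlinarith [le_abs_self x, abs_nonneg x]
  lt x h := by
    simp only [norm_pt_of_ne_top ENNReal.one_ne_top]
    norm_num
    nlinarith [le_abs_self x, abs_nonneg x]
  slope_eq _ := Or.inl rfl

lemma isIncidence_zero (h : p ≠ ∞) : IsIncidence p 0 0 where
  nonneg := le_rfl
  lt_one := zero_lt_one
  slope_nonneg := le_rfl
  le x := by
    have := norm_pt_le_norm_pt (p := p) (x := 0) (y := 1) (x' := x) (y' := 1) (by simp) le_rfl
    simpa using this
  lt x hx := by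
    have h1 := one_le_toReal h
    simp only [norm_pt_zero_left, zero_mul, sub_zero, abs_one]
    rw [norm_pt_of_ne_top h, abs_one, Real.one_rpow]
    apply Real.one_lt_rpow
    · have : 0 < |x| ^ p.toReal := Real.rpow_pos_of_pos (abs_pos.2 hx.ne') _
      linarith
    · positivity
  slope_eq _ := Or.inl rfl

/-- Strict Jensen inequality for the power function, in the form of a supporting line of the
`L_p` unit sphere. -/
lemma add_rpow_lt_one_add_rpow {s u x : ℝ} (hs : 1 < s) (hu0 : 0 < u) (hu1 : u < 1) (hx : 0 ≤ x)
    (hne : u * (1 + x ^ s) ≠ x ^ s) :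
    ((1 - u) ^ (1 - 1 / s) + u ^ (1 - 1 / s) * x) ^ s < 1 + x ^ s := by
  have hu1' : 0 < 1 - u := by linarith
  have key : ∀ a : ℝ, 0 < a → (a ^ (-(1 / s))) ^ s = a⁻¹ := by
    intro a ha
    rw [← Real.rpow_mul ha.le, show -(1 / s) * s = -1 by field_simp, Real.rpow_neg_one]
  have key2 : ∀ a : ℝ, 0 < a → a ^ (1 - 1 / s) = a * a ^ (-(1 / s)) := by
    intro a ha
    rw [sub_eq_add_neg, Real.rpow_add ha, Real.rpow_one]
  have hX : 0 ≤ u ^ (-(1 / s)) * x := by positivity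
  have hxs : (u ^ (-(1 / s)) * x) ^ s = u⁻¹ * x ^ s := by
    rw [Real.mul_rpow (by positivity) hx, key u hu0]
  -- The weights `1 - u` and `u` times the `s`-th powers of these two points are `1` and `x ^ s`;
  -- the points coincide only if `hne` fails.
  have h := (strictConvexOn_rpow hs).2 (x := (1 - u) ^ (-(1 / s))) (y := u ^ (-(1 / s)) * x)
    (mem_Ici.2 (by positivity)) (mem_Ici.2 hX) (fun heq => hne ?_) hu1' hu0 (by ring)
  · simp only [smul_eq_mul, hxs, key _ hu1'] at h
    rw [key2 _ hu1', key2 _ hu0, mul_assoc u]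
    refine h.trans_eq ?_
    field_simp
  · have := congrArg (· ^ s) heq
    simp only [hxs, key _ hu1'] at this
    field_simp at this
    linarith

/-- This is the equality case of Hölder's inequality. With `u = w ^ (s / (1 - s))` the vector `(A,
B)` has `A ^ s + B ^ s = 1`, and `(k, c)` is the dual unit vector, so `c + k x ≤ ‖(x, 1)‖` with
equality among `x ≥ 0` only at `x = A / B`, the tangent of the given angle. -/
lemma isIncidence_rpow (h : p ≠ ∞) (h1 : p ≠ 1) {w : ℝ} (hw : 1 < w) :
    IsIncidence p w⁻¹ (Real.tan (Real.arcsin (w ^ (1 / (1 - p.toReal)) /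
      Real.sqrt (w ^ (2 / (1 - p.toReal)) +
        (1 - w ^ (p.toReal / (1 - p.toReal))) ^ (2 / p.toReal))))) := by
  have hs : 1 < p.toReal := by
    refine lt_of_le_of_ne (one_le_toReal h) fun h' => h1 ?_
    rw [← ENNReal.ofReal_toReal h, ← h', ENNReal.ofReal_one]
  set s := p.toReal with hsdef
  have hw0 : 0 < w := by linarith
  set u := w ^ (s / (1 - s)) with hu
  have hu0 : 0 < u := Real.rpow_pos_of_pos hw0 _
  have hu1 : u < 1 := Real.rpow_lt_one_of_one_lt_of_neg hw
    (div_neg_of_pos_of_neg (by linarith) (by linarith))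
  have hu1' : 0 < 1 - u := by linarith
  set A := w ^ (1 / (1 - s)) with hA
  set B := (1 - u) ^ (1 / s) with hB
  have hA0 : 0 < A := Real.rpow_pos_of_pos hw0 _
  have hB0 : 0 < B := Real.rpow_pos_of_pos hu1' _
  have hs0 : 1 - s ≠ 0 := by linarith
  have hA2 : w ^ (2 / (1 - s)) = A ^ 2 := by
    rw [hA, ← Real.rpow_mul_natCast hw0.le]
    congr 1
    push_cast
    ring
  have hB2 : (1 - u) ^ (2 / s) = B ^ 2 := by
    rw [hB, ← Real.rpow_mul_natCast hu1'.le]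
    congr 1
    push_cast
    ring
  have hk : w⁻¹ = u ^ (1 - 1 / s) := by
    rw [hu, ← Real.rpow_mul hw0.le, ← Real.rpow_neg_one]
    congr 1
    field_simp
    ring
  have hAs : A ^ s = u := by
    rw [hA, hu, ← Real.rpow_mul hw0.le]
    congr 1
    ring
  have hBs : B ^ s = 1 - u := by
    rw [hB, ← Real.rpow_mul hu1'.le, one_div, inv_mul_cancel₀ (by linarith), Real.rpow_one]
  have ht : Real.tan (Real.arcsin (A / Real.sqrt (w ^ (2 / (1 - s)) + (1 - u) ^ (2 / s))))
      = A / B := by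
    rw [Real.tan_arcsin, hA2, hB2, div_pow, Real.sq_sqrt (by positivity),
      show 1 - A ^ 2 / (A ^ 2 + B ^ 2) = B ^ 2 / (A ^ 2 + B ^ 2) by field_simp; ring,
      Real.sqrt_div (by positivity), Real.sqrt_sq hB0.le]
    field_simp
  rw [ht]
  set t := A / B with htdef
  have ht0 : 0 < t := by positivity
  have hts : t ^ s = u / (1 - u) := by
    rw [htdef, Real.div_rpow hA0.le hB0.le, hAs, hBs]
  set c := (1 - u) ^ (1 - 1 / s) with hc
  have hc0 : 0 < c := Real.rpow_pos_of_pos hu1' _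
  have hN : ∀ x, 0 ≤ x → ‖pt p x 1‖ = (1 + x ^ s) ^ (1 / s) := by
    intro x hx
    rw [norm_pt_of_ne_top h, abs_of_nonneg hx, abs_one, Real.one_rpow, add_comm]
  have hval : ‖pt p t 1‖ - w⁻¹ * t = c := by
    have e1 : 1 + t ^ s = (1 - u)⁻¹ := by
      rw [hts]
      field_simp
      ring
    have e2 : B * B⁻¹ = 1 := mul_inv_cancel₀ hB0.ne'
    have e3 : w⁻¹ * A = u := by
      rw [hA, hu, ← Real.rpow_neg_one, ← Real.rpow_add hw0]
      congr 1
      field_simp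
      ring
    rw [hN t ht0.le, e1, Real.inv_rpow hu1'.le, hc, Real.rpow_sub hu1', Real.rpow_one, ← hB,
      htdef, ← mul_div_assoc, e3]
    field_simp
  have hpos : ∀ x, 0 ≤ x → x ≠ t → c < ‖pt p x 1‖ - w⁻¹ * x := by
    intro x hx hxt
    have := add_rpow_lt_one_add_rpow hs hu0 hu1 hx fun heq => hxt ?_
    · rw [← hk, ← hc] at this
      have h2 := Real.rpow_lt_rpow (z := 1 / s) (by positivity) this (by positivity)
      rw [← Real.rpow_mul (by positivity), mul_one_div_cancel (by linarith), Real.rpow_one,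
        ← hN x hx] at h2
      linarith
    · have : x ^ s = t ^ s := by
        rw [hts]
        field_simp
        linarith
      exact (Real.rpow_left_inj hx ht0.le (by linarith)).1 this
  have hle : ∀ x, 0 ≤ x → c ≤ ‖pt p x 1‖ - w⁻¹ * x := by
    intro x hx
    by_cases hxt : x = t
    · rw [hxt, hval]
    · exact (hpos x hx hxt).le
  have hk0 : 0 < w⁻¹ := inv_pos.2 hw0
  refine ⟨hk0.le, inv_lt_one_of_one_lt₀ hw, ht0.le, fun x => ?_, fun x hx => ?_, fun hk => ?_⟩
  · rw [hval]
    -- A negative abscissa is no better than its absolute value, since `k ≥ 0`.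
    refine (hle |x| (abs_nonneg x)).trans ?_
    rw [norm_pt_congr (p := p) (x' := x) (y' := 1) (abs_abs x) rfl]
    nlinarith [le_abs_self x]
  · rw [hval]
    exact hpos x (by linarith) hx.ne'
  · exact absurd hk hk0.ne'

lemma isIncidence_angle (p v : ℝ≥0∞) [Fact (1 ≤ p)] (hv : 1 < v) :
    IsIncidence p (v⁻¹).toReal (Real.tan (angle p v)) := by
  have hk1 : (v⁻¹).toReal < 1 := by
    have : v⁻¹ < 1 := ENNReal.inv_lt_one.2 hv
    simpa using (ENNReal.toReal_lt_toReal this.ne_top ENNReal.one_ne_top).2 this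
  unfold angle
  split_ifs with h1 h2
  · subst h1
    rw [Real.tan_pi_div_four]
    exact isIncidence_top ENNReal.toReal_nonneg hk1
  · rw [Real.tan_zero]
    by_cases h3 : p = 1
    · subst h3
      exact isIncidence_one ENNReal.toReal_nonneg hk1
    · have := h2.resolve_left h3
      subst this
      simpa using isIncidence_zero h1
  · push Not at h2
    rw [ENNReal.toReal_inv]
    refine isIncidence_rpow h1 h2.1 ?_
    simpa using (ENNReal.toReal_lt_toReal ENNReal.one_ne_top h2.2).2 hv

end Highway

/-! ### Convexity and the discriminating abscissa. -/

namespace Highway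

lemma strictMonoOn_Ici_of_convexOn {f : ℝ → ℝ} (hf : ConvexOn ℝ univ f) {m : ℝ}
    (hm : ∀ x, m < x → f m < f x) : StrictMonoOn f (Ici m) := by
  intro x hx y _ hxy
  rcases (mem_Ici.1 hx).eq_or_lt with rfl | hx
  · exact hm y hxy
  · have h0 : 0 < y - m := by linarith
    have h := hf.2 (mem_univ m) (mem_univ y) (show 0 ≤ (y - x) / (y - m) by
        apply div_nonneg <;> linarith) (show 0 ≤ (x - m) / (y - m) by
        apply div_nonneg <;> linarith)
      (by field_simp; ring)
    have e : (y - x) / (y - m) * m + (x - m) / (y - m) * y = x := by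
      field_simp
      ring
    simp only [smul_eq_mul, e] at h
    have h1 : (y - x) / (y - m) * f m < (y - x) / (y - m) * f y := by
      have := hm y (hx.trans hxy)
      have : 0 < (y - x) / (y - m) := by apply div_pos <;> linarith
      gcongr
    calc f x < (y - x) / (y - m) * f y + (x - m) / (y - m) * f y := by linarith
      _ = f y := by field_simp; ring

lemma antitoneOn_Iic_of_convexOn {f : ℝ → ℝ} (hf : ConvexOn ℝ univ f) {m : ℝ}
    (hm : ∀ x, f m ≤ f x) : AntitoneOn f (Iic m) := by
  intro x _ y hy hxy
  rcases (mem_Iic.1 hy).eq_or_lt with rfl | hy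
  · exact hm x
  · have h0 : 0 < m - x := by linarith
    have h := hf.2 (mem_univ x) (mem_univ m) (show 0 ≤ (m - y) / (m - x) by
        apply div_nonneg <;> linarith) (show 0 ≤ (y - x) / (m - x) by
        apply div_nonneg <;> linarith)
      (by field_simp; ring)
    have e : (m - y) / (m - x) * x + (y - x) / (m - x) * m = y := by
      field_simp
      ring
    simp only [smul_eq_mul, e] at h
    have h1 : (y - x) / (m - x) * f m ≤ (y - x) / (m - x) * f x := by
      have := hm x
      have : 0 ≤ (y - x) / (m - x) := by apply div_nonneg <;> linarith
      gcongr
    calc f y ≤ (m - y) / (m - x) * f x + (y - x) / (m - x) * f x := by linarith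
      _ = f x := by field_simp; ring

variable {p : ℝ≥0∞} [hp : Fact (1 ≤ p)]

namespace IsIncidence

variable {k t : ℝ} (H : IsIncidence p k t)
include H

/-- Homogeneity reduces a positive height to `1`; at height `0` only `k x ≤ |x|` is left, which uses
`0 ≤ k < 1`. -/
lemma scale_le {s : ℝ} (hs : 0 ≤ s) (x : ℝ) :
    s * (‖pt p t 1‖ - k * t) ≤ ‖pt p x s‖ - k * x := by
  rcases hs.eq_or_lt with rfl | hs
  · rw [norm_pt_zero_right]
    nlinarith [le_abs_self x, abs_nonneg x, H.nonneg, H.lt_one]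
  · have h := mul_le_mul_of_nonneg_left (H.le (x / s)) hs.le
    have e := norm_pt_smul (p := p) s (x / s) 1
    rw [mul_div_cancel₀ _ hs.ne', mul_one, abs_of_pos hs] at e
    have e2 : s * (k * (x / s)) = k * x := by field_simp
    rw [mul_sub s ‖pt p (x / s) 1‖, e2, ← e] at h
    exact h

lemma scale_lt {s : ℝ} (hs : 0 ≤ s) {x : ℝ} (hx : t * s < x) :
    s * (‖pt p t 1‖ - k * t) < ‖pt p x s‖ - k * x := by
  rcases hs.eq_or_lt with rfl | hs
  · rw [norm_pt_zero_right]
    nlinarith [le_abs_self x, H.lt_one]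
  · have h := mul_lt_mul_of_pos_left (H.lt (x / s) ((lt_div_iff₀ hs).2 hx)) hs
    have e := norm_pt_smul (p := p) s (x / s) 1
    rw [mul_div_cancel₀ _ hs.ne', mul_one, abs_of_pos hs] at e
    have e2 : s * (k * (x / s)) = k * x := by field_simp
    rw [mul_sub s ‖pt p (x / s) 1‖, e2, ← e] at h
    exact h

lemma strictMonoOn {s : ℝ} (hs : 0 ≤ s) :
    StrictMonoOn (fun x => ‖pt p x s‖ - k * x) (Ici (t * s)) := by
  refine strictMonoOn_Ici_of_convexOn (convexOn_norm_pt_sub s k) fun x hx => ?_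
  have := H.scale_lt hs hx
  simp only [norm_pt_mul_left t hs]
  linarith

lemma antitoneOn {s : ℝ} (hs : 0 ≤ s) :
    AntitoneOn (fun x => ‖pt p x s‖ - k * x) (Iic (t * s)) := by
  refine antitoneOn_Iic_of_convexOn (convexOn_norm_pt_sub s k) fun x => ?_
  have := H.scale_le hs x
  simp only [norm_pt_mul_left t hs]
  linarith

/-- The minimiser for height `|y - b|` is `t |y - b|`, which lies to the left of `t (b + y)`. -/
lemma strictMonoOn_sub {b y : ℝ} (hb : 0 ≤ b) (hy : 0 ≤ y) :
    StrictMonoOn (fun x => ‖pt p x (y - b)‖ - k * x) (Ici (t * (b + y))) := by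
  have h := (H.strictMonoOn (abs_nonneg (y - b))).mono
    (Ici_subset_Ici.2 (mul_le_mul_of_nonneg_left (show |y - b| ≤ b + y from
      abs_le.2 ⟨by linarith, by linarith⟩) H.slope_nonneg))
  intro x hx x' hx' hxx
  have := h hx hx' hxx
  simp only [norm_pt_congr (p := p) (y' := y - b) rfl (abs_abs (y - b))] at this
  exact this

/-- The discriminating abscissa at height `y`, relative to a point at height `b`. -/
lemma exists_root {b y : ℝ} (hb : 0 ≤ b) (hy : 0 ≤ y) :
    ∃ d, t * (b + y) ≤ d ∧ ‖pt p d (y - b)‖ = (b + y) * (‖pt p t 1‖ - k * t) + k * d := by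
  set s := b + y with hs
  have hs0 : 0 ≤ s := by linarith
  set c := ‖pt p t 1‖ - k * t with hc
  have h1k : 0 < 1 - k := by linarith [H.lt_one]
  -- Beyond `s * c / (1 - k)` the bound `‖(x, y - b)‖ ≥ x` alone pushes the function above `s * c`.
  set M := max (t * s) (s * c / (1 - k)) with hM
  have hcont : ContinuousOn (fun x => ‖pt p x (y - b)‖ - k * x) (Icc (t * s) M) := by
    apply Continuous.continuousOn
    exact (continuous_norm_pt.comp (by fun_prop : Continuous fun x : ℝ => (x, y - b))).sub
      (by fun_prop)
  have hlow : ‖pt p (t * s) (y - b)‖ - k * (t * s) ≤ s * c := by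
    have : ‖pt p (t * s) (y - b)‖ ≤ ‖pt p (t * s) s‖ :=
      norm_pt_le_norm_pt le_rfl (by
        rw [abs_of_nonneg hs0]
        exact abs_le.2 ⟨by linarith, by linarith⟩)
    rw [norm_pt_mul_left t hs0] at this
    rw [hc]
    linarith
  have hhigh : s * c ≤ ‖pt p M (y - b)‖ - k * M := by
    have h1 := abs_le_norm_pt (p := p) M (y - b)
    have h2 : s * c / (1 - k) ≤ M := le_max_right _ _
    rw [div_le_iff₀ h1k] at h2
    linarith [le_abs_self M]
  obtain ⟨d, hd, hd'⟩ := intermediate_value_Icc (le_max_left _ _) hcont ⟨hlow, hhigh⟩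
  simp only at hd'
  exact ⟨d, hd.1, by linarith⟩

/-- Continuity comes from monotonicity: to the right of the barrier `t (b + y)` the sign of `F y a`
tells on which side of the root `a` lies, and a strict sign persists for nearby `y`. Heights are
clamped by `max y 0` so that the root is defined on the whole line. -/
lemma exists_continuous_root {b : ℝ} (hb : 0 ≤ b) :
    ∃ ρ : ℝ → ℝ, Continuous ρ ∧ ρ 0 = t * b ∧ (∀ y, 0 ≤ y → t * (b + y) ≤ ρ y) ∧
      ∀ y, 0 ≤ y → ‖pt p (ρ y) (y - b)‖ = (b + y) * (‖pt p t 1‖ - k * t) + k * ρ y := by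
  have hex : ∀ y : ℝ, ∃ d, t * (b + max y 0) ≤ d ∧
      ‖pt p d (max y 0 - b)‖ = (b + max y 0) * (‖pt p t 1‖ - k * t) + k * d :=
    fun y => H.exists_root hb (le_max_right y 0)
  choose ρ h1 h2 using hex
  refine ⟨ρ, ?_, ?_, fun y hy => ?_, fun y hy => ?_⟩
  · set F : ℝ → ℝ → ℝ := fun y x => ‖pt p x (max y 0 - b)‖ - k * x -
      (b + max y 0) * (‖pt p t 1‖ - k * t) with hF
    have hFc : ∀ x, Continuous fun y => F y x := by
      intro x
      simp only [hF]
      exact ((continuous_norm_pt.comp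
        (by fun_prop : Continuous fun y : ℝ => (x, max y 0 - b))).sub (by fun_prop)).sub
        (by fun_prop)
    have hF0 : ∀ y, F y (ρ y) = 0 := by
      intro y
      simp only [hF, h2 y]
      ring
    have hmono : ∀ y x x', t * (b + max y 0) ≤ x → x < x' → F y x < F y x' := by
      intro y x x' hx hxx
      have := H.strictMonoOn_sub hb (le_max_right y 0) (mem_Ici.2 hx)
        (mem_Ici.2 (hx.trans hxx.le)) hxx
      simp only [hF] at this ⊢
      linarith
    have hlin : Continuous fun y : ℝ => t * (b + max y 0) := by fun_prop
    rw [continuous_iff_continuousAt]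
    intro y₀
    refine tendsto_order.2 ⟨fun a ha => ?_, fun a ha => ?_⟩
    · by_cases hat : a < t * (b + max y₀ 0)
      · filter_upwards [hlin.continuousAt.eventually_const_lt hat] with y hy
        exact hy.trans_le (h1 y)
      · push Not at hat
        have hneg : F y₀ a < 0 := by
          rw [← hF0 y₀]
          exact hmono y₀ _ _ hat ha
        filter_upwards [(hFc a).continuousAt.eventually_lt_const hneg] with y hy
        by_contra! hle
        rcases hle.eq_or_lt with h | h
        · rw [← h, hF0] at hy
          exact lt_irrefl _ hy
        · have := hmono y _ _ (h1 y) h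
          rw [hF0] at this
          linarith
    · have hpos : 0 < F y₀ a := by
        rw [← hF0 y₀]
        exact hmono y₀ _ _ (h1 y₀) ha
      filter_upwards [(hFc a).continuousAt.eventually_const_lt hpos,
        hlin.continuousAt.eventually_lt_const ((h1 y₀).trans_lt ha)] with y hy hy'
      by_contra! hle
      rcases hle.eq_or_lt with h | h
      · rw [h, hF0] at hy
        exact lt_irrefl _ hy
      · have := hmono y _ _ hy'.le h
        rw [hF0] at this
        linarith
  · have h1' := h1 0
    have h2' := h2 0
    simp only [max_self, add_zero, zero_sub] at h1' h2'
    rw [norm_pt_congr (p := p) (x' := ρ 0) (y' := b) rfl (abs_neg b)] at h2'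
    refine le_antisymm ?_ h1'
    by_contra! hlt
    have := H.scale_lt hb hlt
    linarith
  · simpa [max_eq_left hy] using h1 y
  · simpa [max_eq_left hy] using h2 y

/-- The equation of the right discriminating curve determines the abscissa. -/
lemma eq_root {b y d r : ℝ} (hb : 0 < b) (hy : 0 ≤ y) (hr : t * (b + y) ≤ r)
    (hr' : ‖pt p r (y - b)‖ = (b + y) * (‖pt p t 1‖ - k * t) + k * r) (hd : t * b ≤ d)
    (hd' : ‖pt p d (y - b)‖ = b * ‖pt p t 1‖ + y * ‖pt p t 1‖ + k * |d - t * (b + y)|) :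
    d = r := by
  have hs0 : 0 ≤ b + y := by linarith
  have hd1 : t * (b + y) ≤ d := by
    -- If the feet were crossed, the right side would be `(b + y) ‖(t, 1)‖` plus a riding cost,
    -- while the left side is at most `(b + y) ‖(t, 1)‖`. This is a contradiction at once for `k >
    -- 0`.
    by_contra! hlt
    rw [abs_of_neg (by linarith)] at hd'
    have hd0 : 0 ≤ d := (mul_nonneg H.slope_nonneg hb.le).trans hd
    have hle : ‖pt p d (y - b)‖ ≤ ‖pt p (t * (b + y)) (b + y)‖ := by
      refine norm_pt_le_norm_pt ?_ ?_
      · rw [abs_of_nonneg hd0, abs_of_nonneg (hd0.trans hlt.le)]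
        exact hlt.le
      · rw [abs_of_nonneg hs0]
        exact abs_le.2 ⟨by linarith, by linarith⟩
    rw [norm_pt_mul_left t hs0] at hle
    rcases H.nonneg.eq_or_lt with hk | hk
    · rcases H.slope_eq hk.symm with rfl | ⟨rfl, rfl⟩
      · linarith
      · rw [← hk, norm_pt_top, norm_pt_top, abs_of_nonneg hd0] at hd'
        have : max d |y - b| < b + y := max_lt (by linarith)
          (abs_lt.2 ⟨by linarith, by linarith⟩)
        norm_num at hd'
        rw [hd'] at this
        exact lt_irrefl _ this
    · nlinarith
  rw [abs_of_nonneg (by linarith)] at hd'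
  refine (H.strictMonoOn_sub hb.le hy).injOn (mem_Ici.2 hd1) (mem_Ici.2 hr) ?_
  simp only [hd', hr']
  ring

/-- The cost of a detour over the highway is at least the length of the direct walk, for abscissae
up to the discriminating one. -/
lemma direct_le_detour {b y d r e f : ℝ} (hb : 0 ≤ b) (hy : 0 ≤ y) (hr : t * (b + y) ≤ r)
    (hr' : ‖pt p r (y - b)‖ = (b + y) * (‖pt p t 1‖ - k * t) + k * r) (hd : |d| ≤ r) :
    ‖pt p d (y - b)‖ ≤ ‖pt p e y‖ + k * |d - (e + f)| + ‖pt p f b‖ := by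
  have hs0 : 0 ≤ b + y := by linarith
  -- Reflecting one leg in the road joins both legs into a single vector of height `b + y`.
  set u := |e + f| with hu
  have h1 : ‖pt p u (b + y)‖ ≤ ‖pt p e y‖ + ‖pt p f b‖ := by
    rw [norm_pt_congr (p := p) (x' := e + f) (y' := y + b) (abs_abs _) (by rw [add_comm])]
    exact norm_pt_add_le e y f b
  have h2 : |(|d| - u)| ≤ |d - (e + f)| := abs_abs_sub_abs_le_abs_sub _ _
  have h3 : k * |(|d| - u)| ≤ k * |d - (e + f)| := mul_le_mul_of_nonneg_left h2 H.nonneg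
  rw [norm_pt_congr (p := p) (x := d) (x' := |d|) (abs_abs d).symm rfl]
  suffices h : ‖pt p |d| (y - b)‖ ≤ ‖pt p u (b + y)‖ + k * |(|d| - u)| by linarith
  have hd0 := abs_nonneg d
  have hu0 : 0 ≤ u := abs_nonneg _
  generalize |d| = D at *
  have hyb : |y - b| ≤ |b + y| := by
    rw [abs_of_nonneg hs0]
    exact abs_le.2 ⟨by linarith, by linarith⟩
  rcases le_total (t * (b + y)) D with hD | hD
  · have h4 := (H.strictMonoOn_sub hb hy).monotoneOn (mem_Ici.2 hD) (mem_Ici.2 hr) hd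
    have h5 := H.scale_le hs0 u
    have h6 : k * (D - u) ≤ k * |D - u| := mul_le_mul_of_nonneg_left (le_abs_self _) H.nonneg
    simp only [hr'] at h4
    linarith
  -- Here `D` is left of the barrier. After raising the height to `b + y`, either `u ≥ D` and the
  -- norm is monotone, or `u ≤ D` and the cost less the saving decreases up to `t (b + y)`.
  · have h4 : ‖pt p D (y - b)‖ ≤ ‖pt p D (b + y)‖ := norm_pt_le_norm_pt le_rfl hyb
    rcases le_total D u with hDu | hDu
    · have h5 : ‖pt p D (b + y)‖ ≤ ‖pt p u (b + y)‖ :=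
        norm_pt_le_norm_pt (by rwa [abs_of_nonneg hd0, abs_of_nonneg hu0]) le_rfl
      have := mul_nonneg H.nonneg (abs_nonneg (D - u))
      linarith
    · have h5 := H.antitoneOn hs0 (mem_Iic.2 (hDu.trans hD)) (mem_Iic.2 hD) hDu
      have h6 : k * (D - u) ≤ k * |D - u| := mul_le_mul_of_nonneg_left (le_abs_self _) H.nonneg
      simp only at h5
      linarith

/-- Beyond the discriminating abscissa the highway is strictly faster. -/
lemma detour_lt_direct {b y d r : ℝ} (hb : 0 ≤ b) (hy : 0 ≤ y) (hr : t * (b + y) ≤ r)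
    (hr' : ‖pt p r (y - b)‖ = (b + y) * (‖pt p t 1‖ - k * t) + k * r) (hd : r < |d|) :
    (b + y) * (‖pt p t 1‖ - k * t) + k * |d| < ‖pt p d (y - b)‖ := by
  have h4 := H.strictMonoOn_sub hb hy (mem_Ici.2 hr) (mem_Ici.2 (hr.trans hd.le)) hd
  simp only [hr'] at h4
  rw [norm_pt_congr (p := p) (x := d) (x' := |d|) (abs_abs d).symm rfl]
  linarith

end IsIncidence

end Highway

/-! ### Bounds for the traveling time. -/

namespace Highway

open Filter Topology

variable {p v : ℝ≥0∞}

lemma slowness_of_disjoint {S : Set (Plane p)} (h : Disjoint S (road p)) :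
    slowness p v S = 1 := if_pos h

lemma slowness_of_not_disjoint {S : Set (Plane p)} (h : ¬ Disjoint S (road p)) :
    slowness p v S = v⁻¹ := if_neg h

lemma inv_le_slowness (hv : 1 < v) (S : Set (Plane p)) : v⁻¹ ≤ slowness p v S := by
  unfold slowness
  split_ifs
  · exact (ENNReal.inv_lt_one.2 hv).le
  · exact le_rfl

lemma slowness_le_one (hv : 1 < v) (S : Set (Plane p)) : slowness p v S ≤ 1 := by
  unfold slowness
  split_ifs
  · exact le_rfl
  · exact (ENNReal.inv_lt_one.2 hv).le

lemma isClosed_road : IsClosed (road p) :=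
  isClosed_eq (by fun_prop : Continuous fun z : Plane p => z 1) continuous_const

variable [hp : Fact (1 ≤ p)]

/-- The cost of the chord from parameter `s` to parameter `t` in a lower sum. -/
noncomputable def chordCost (v : ℝ≥0∞) {a b : Plane p} (γ : Path a b) (s t : unitInterval) : ℝ≥0∞ :=
  slowness p v (γ '' Icc s t) * edist (γ s) (γ t)

/-- A potential whose increments dominate the chord costs bounds every lower sum by telescoping. -/
lemma travelTime_le_of_chordCost_le {a b : Plane p} (γ : Path a b) {G : unitInterval → ℝ}
    (hG : Monotone G)
    (h : ∀ s t, s ≤ t → chordCost v γ s t ≤ ENNReal.ofReal (G t - G s)) :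
    travelTime v γ ≤ ENNReal.ofReal (G 1 - G 0) := by
  refine iSup_le fun n => iSup_le fun u => iSup_le fun hu => ?_
  calc ∑ i ∈ Finset.range n,
      slowness p v (γ '' Icc (u i) (u (i + 1))) * edist (γ (u i)) (γ (u (i + 1)))
      ≤ ∑ i ∈ Finset.range n, ENNReal.ofReal (G (u (i + 1)) - G (u i)) :=
        Finset.sum_le_sum fun i _ => h _ _ (hu i.le_succ)
    _ = ENNReal.ofReal (G (u n) - G (u 0)) := by
        rw [← ENNReal.ofReal_sum_of_nonneg fun i _ => sub_nonneg.2 (hG (hu i.le_succ)),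
          Finset.sum_range_sub (fun i => G (u i))]
    _ ≤ ENNReal.ofReal (G 1 - G 0) :=
        ENNReal.ofReal_le_ofReal (sub_le_sub (hG (u n).2.2) (hG (u 0).2.1))

lemma chordCost_add_le_travelTime {a b : Plane p} (γ : Path a b) {s t : unitInterval}
    (hst : s ≤ t) :
    chordCost v γ 0 s + chordCost v γ s t + chordCost v γ t 1 ≤ travelTime v γ := by
  let u : ℕ → unitInterval
    | 0 => 0
    | 1 => s
    | 2 => t
    | _ => 1
  have hu : Monotone u := by
    refine monotone_nat_of_le_succ fun n => ?_
    match n with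
    | 0 => exact s.2.1
    | 1 => exact hst
    | 2 => exact t.2.2
    | _ + 3 => exact le_rfl
  refine le_trans (le_of_eq ?_) (le_iSup_of_le 3 (le_iSup_of_le u (le_iSup_of_le hu le_rfl)))
  simp [Finset.sum_range_succ, chordCost, u]

lemma edist_le_travelTime {a b : Plane p} (γ : Path a b) (h : ¬ EntersRoad γ) :
    edist a b ≤ travelTime v γ := by
  have hd : ∀ s t, chordCost v γ s t = edist (γ s) (γ t) := by
    intro s t
    rw [chordCost, slowness_of_disjoint, one_mul]
    refine Set.disjoint_left.2 ?_
    rintro _ ⟨x, _, rfl⟩ hx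
    exact h ⟨γ x, ⟨x, rfl⟩, hx⟩
  have := chordCost_add_le_travelTime (v := v) γ (zero_le_one (α := unitInterval))
  simpa [hd] using this

/-- The points are the first and last ones of the curve on the road. A closed piece that ends on the
road already has slowness `1 / v`, so the partition is cut strictly before the first and strictly
after the last such parameter, where the outer pieces have slowness `1`, and the cuts then tend to
these parameters. -/
lemma exists_detour_le_travelTime (hv : 1 < v) {a b : Plane p} (ha : a ∉ road p)
    (hb : b ∉ road p) (γ : Path a b) (h : EntersRoad γ) :
    ∃ z ∈ road p, ∃ w ∈ road p,
      ENNReal.ofReal (dist a z + (v⁻¹).toReal * dist z w + dist w b) ≤ travelTime v γ := by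
  set K : Set unitInterval := γ ⁻¹' road p with hK
  have hKc : IsCompact K := (isClosed_road.preimage γ.continuous).isCompact
  have hKn : K.Nonempty := by
    obtain ⟨_, ⟨x, rfl⟩, hx⟩ := h
    exact ⟨x, hx⟩
  obtain ⟨s₀, hs₀, hs₀'⟩ := hKc.exists_isLeast hKn
  obtain ⟨t₀, ht₀, ht₀'⟩ := hKc.exists_isGreatest hKn
  have hst : s₀ ≤ t₀ := hs₀' ht₀
  have hs0 : 0 < s₀ := by
    refine lt_of_le_of_ne s₀.2.1 fun h0 => ha ?_
    rw [← h0] at hs₀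
    simpa [hK] using hs₀
  have ht1 : t₀ < 1 := by
    refine lt_of_le_of_ne t₀.2.2 fun h1 => hb ?_
    rw [h1] at ht₀
    simpa [hK] using ht₀
  refine ⟨γ s₀, hs₀, γ t₀, ht₀, ?_⟩
  have hk : v⁻¹ ≠ ∞ := (ENNReal.inv_lt_one.2 hv).ne_top
  have key : ∀ s < s₀, ∀ t, t₀ < t →
      ENNReal.ofReal (dist a (γ s) + (v⁻¹).toReal * dist (γ s) (γ t) + dist (γ t) b) ≤
        travelTime v γ := by
    intro s hs t ht
    refine le_trans ?_ (chordCost_add_le_travelTime γ ((hs.le.trans hst).trans ht.le))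
    have h1 : chordCost v γ 0 s = edist a (γ s) := by
      rw [chordCost, slowness_of_disjoint, one_mul, γ.source]
      refine Set.disjoint_left.2 ?_
      rintro _ ⟨x, hx, rfl⟩ hx'
      exact absurd (hs₀' hx') (not_le.2 (hx.2.trans_lt hs))
    have h3 : chordCost v γ t 1 = edist (γ t) b := by
      rw [chordCost, slowness_of_disjoint, one_mul, γ.target]
      refine Set.disjoint_left.2 ?_
      rintro _ ⟨x, hx, rfl⟩ hx'
      exact absurd (ht₀' hx') (not_le.2 (ht.trans_le hx.1))
    have h2 : v⁻¹ * edist (γ s) (γ t) ≤ chordCost v γ s t := by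
      unfold chordCost
      gcongr
      exact inv_le_slowness hv _
    rw [h1, h3, ENNReal.ofReal_add (by positivity) (by positivity),
      ENNReal.ofReal_add (by positivity) (by positivity),
      ENNReal.ofReal_mul ENNReal.toReal_nonneg, ENNReal.ofReal_toReal hk, ← edist_dist,
      ← edist_dist, ← edist_dist]
    gcongr
  have key2 : ∀ t, t₀ < t →
      ENNReal.ofReal (dist a (γ s₀) + (v⁻¹).toReal * dist (γ s₀) (γ t) + dist (γ t) b) ≤
        travelTime v γ := by
    intro t ht
    have : (𝓝[<] s₀).NeBot := nhdsLT_neBot_of_exists_lt ⟨0, hs0⟩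
    have hc : Continuous fun s => ENNReal.ofReal
        (dist a (γ s) + (v⁻¹).toReal * dist (γ s) (γ t) + dist (γ t) b) :=
      ENNReal.continuous_ofReal.comp (by fun_prop)
    refine le_of_tendsto (hc.continuousWithinAt (s := Iio s₀) (x := s₀)) ?_
    filter_upwards [self_mem_nhdsWithin] with s hs using key s hs t ht
  have : (𝓝[>] t₀).NeBot := nhdsGT_neBot_of_exists_gt ⟨1, ht1⟩
  have hc : Continuous fun t => ENNReal.ofReal
      (dist a (γ s₀) + (v⁻¹).toReal * dist (γ s₀) (γ t) + dist (γ t) b) :=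
      ENNReal.continuous_ofReal.comp (by fun_prop)
  refine le_of_tendsto (hc.continuousWithinAt (s := Ioi t₀) (x := t₀)) ?_
  filter_upwards [self_mem_nhdsWithin] with t ht using key2 t ht

lemma travelTime_segment_le (hv : 1 < v) (a b : Plane p) :
    travelTime v (Path.segment a b) ≤ edist a b := by
  have h := travelTime_le_of_chordCost_le (v := v) (Path.segment a b)
    (G := fun t => (t : ℝ) * dist a b)
    (fun s t hst => mul_le_mul_of_nonneg_right hst dist_nonneg) fun s t hst => ?_
  · simpa [edist_dist] using h
  · calc chordCost v (Path.segment a b) s t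
        ≤ 1 * edist (Path.segment a b s) (Path.segment a b t) := by
          unfold chordCost
          gcongr
          exact slowness_le_one hv _
      _ = ENNReal.ofReal ((t : ℝ) * dist a b - s * dist a b) := by
          rw [one_mul, edist_dist]
          congr 1
          have : (s : ℝ) ≤ t := hst
          simp only [Path.segment_apply]
          rw [dist_lineMap_lineMap, Real.dist_eq, abs_sub_comm, abs_of_nonneg (by linarith)]
          ring

/-- The progress of a unit-time motion starting at time `c`. -/
def ramp (c x : ℝ) : ℝ := max 0 (min 1 (x - c))

lemma monotone_ramp (c : ℝ) : Monotone (ramp c) := by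
  intro x y h
  unfold ramp
  gcongr

lemma ramp_of_le {c x : ℝ} (h : x ≤ c) : ramp c x = 0 := by
  rw [ramp, max_eq_left]
  exact (min_le_right _ _).trans (by linarith)

lemma ramp_of_ge {c x : ℝ} (h : c + 1 ≤ x) : ramp c x = 1 := by
  rw [ramp, min_eq_left (by linarith), max_eq_right zero_le_one]

lemma continuous_ramp (c : ℝ) : Continuous (ramp c) := by
  unfold ramp
  fun_prop

/-- The polygonal path through `a`, `z`, `w`, `b`. -/
def polygonalPath (a z w b : Plane p) : Path a b where
  toFun t := a + ramp 0 (3 * t) • (z - a) + ramp 1 (3 * t) • (w - z) + ramp 2 (3 * t) • (b - w)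
  continuous_toFun := by
    have := continuous_ramp
    fun_prop
  source' := by simp [ramp_of_le]
  target' := by
    rw [ramp_of_ge, ramp_of_ge, ramp_of_ge] <;> norm_num

lemma polygonalPath_apply (a z w b : Plane p) (t : unitInterval) :
    polygonalPath a z w b t =
      a + ramp 0 (3 * t) • (z - a) + ramp 1 (3 * t) • (w - z) + ramp 2 (3 * t) • (b - w) := rfl

lemma polygonalPath_mem_road {a z w b : Plane p} (hz : z ∈ road p) (hw : w ∈ road p)
    {t : unitInterval} (h1 : 1 ≤ 3 * (t : ℝ)) (h2 : 3 * (t : ℝ) ≤ 2) :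
    polygonalPath a z w b t ∈ road p := by
  have hz' : z 1 = 0 := hz
  have hw' : w 1 = 0 := hw
  rw [polygonalPath_apply, ramp_of_ge (by linarith), ramp_of_le h2]
  simp [road, hz', hw']

/-- The potential `G` charges the middle ramp at rate `k`. A chord whose piece meets the road is
charged `k ≤ 1` throughout; one whose piece misses it makes no progress in the middle ramp. -/
lemma travelTime_polygonalPath_le (hv : 1 < v) (a b : Plane p) {z w : Plane p}
    (hz : z ∈ road p) (hw : w ∈ road p) :
    travelTime v (polygonalPath a z w b) ≤
      ENNReal.ofReal (dist a z + (v⁻¹).toReal * dist z w + dist w b) := by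
  set k := (v⁻¹).toReal with hk
  have hk0 : 0 ≤ k := ENNReal.toReal_nonneg
  have hkt : v⁻¹ ≠ ∞ := (ENNReal.inv_lt_one.2 hv).ne_top
  have hk1 : k ≤ 1 := by
    have := ENNReal.toReal_mono ENNReal.one_ne_top (ENNReal.inv_lt_one.2 hv).le
    rwa [ENNReal.toReal_one] at this
  set G : unitInterval → ℝ := fun t => ramp 0 (3 * t) * dist a z +
    k * (ramp 1 (3 * t) * dist z w) + ramp 2 (3 * t) * dist w b with hG
  have hle : ∀ s t : unitInterval, s ≤ t → ∀ c, ramp c (3 * s) ≤ ramp c (3 * t) := by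
    intro s t hst c
    have : (s : ℝ) ≤ t := hst
    exact monotone_ramp c (by linarith)
  have hGm : Monotone G := by
    intro s t hst
    have h := hle s t hst
    simp only [hG]
    gcongr <;> exact h _
  have h := travelTime_le_of_chordCost_le (v := v) (polygonalPath a z w b) hGm
    fun s t hst => ?_
  · refine h.trans_eq ?_
    congr 1
    simp only [hG, Icc.coe_one, Icc.coe_zero, mul_zero]
    rw [ramp_of_ge, ramp_of_ge, ramp_of_ge, ramp_of_le, ramp_of_le, ramp_of_le] <;> norm_num
  · have h := hle s t hst
    have hd : dist (polygonalPath a z w b s) (polygonalPath a z w b t) ≤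
        (ramp 0 (3 * t) - ramp 0 (3 * s)) * dist a z +
        (ramp 1 (3 * t) - ramp 1 (3 * s)) * dist z w +
        (ramp 2 (3 * t) - ramp 2 (3 * s)) * dist w b := by
      have e : polygonalPath a z w b t - polygonalPath a z w b s =
          (ramp 0 (3 * t) - ramp 0 (3 * s)) • (z - a) +
          (ramp 1 (3 * t) - ramp 1 (3 * s)) • (w - z) +
          (ramp 2 (3 * t) - ramp 2 (3 * s)) • (b - w) := by
        simp only [polygonalPath_apply]
        module
      rw [dist_comm, dist_eq_norm, e, dist_comm a z, dist_comm z w, dist_comm w b,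
        dist_eq_norm, dist_eq_norm, dist_eq_norm]
      refine norm_add₃_le.trans_eq ?_
      rw [norm_smul, norm_smul, norm_smul, Real.norm_of_nonneg (sub_nonneg.2 (h 0)),
        Real.norm_of_nonneg (sub_nonneg.2 (h 1)), Real.norm_of_nonneg (sub_nonneg.2 (h 2))]
    have d0 := mul_nonneg (sub_nonneg.2 (h 0)) (dist_nonneg (x := a) (y := z))
    have d1 := mul_nonneg (sub_nonneg.2 (h 1)) (dist_nonneg (x := z) (y := w))
    have d2 := mul_nonneg (sub_nonneg.2 (h 2)) (dist_nonneg (x := w) (y := b))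
    unfold chordCost
    by_cases hdis : Disjoint (polygonalPath a z w b '' Icc s t) (road p)
    · rw [slowness_of_disjoint hdis, one_mul, edist_dist]
      apply ENNReal.ofReal_le_ofReal
      have hr : ramp 1 (3 * t) = ramp 1 (3 * s) := by
        rcases lt_or_ge (3 * (t : ℝ)) 1 with ht | ht
        · have : (s : ℝ) ≤ t := hst
          rw [ramp_of_le ht.le, ramp_of_le (by linarith)]
        rcases lt_or_ge 2 (3 * (s : ℝ)) with hs | hs
        · have : (s : ℝ) ≤ t := hst
          rw [ramp_of_ge (by linarith), ramp_of_ge (by linarith)]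
        exfalso
        -- The parameter `max s (1 / 3)` lies in `[s, t]` and in the middle third, which runs on the
        -- road.
        have hm : max (s : ℝ) (1 / 3) ≤ t := max_le hst (by linarith)
        refine Set.disjoint_left.1 hdis ⟨⟨max (s : ℝ) (1 / 3), le_max_of_le_left s.2.1,
          hm.trans t.2.2⟩, ⟨le_max_left (s : ℝ) _, hm⟩, rfl⟩ (polygonalPath_mem_road hz hw ?_ ?_)
        · linarith [le_max_right (s : ℝ) (1 / 3)]
        · have : max (s : ℝ) (1 / 3) ≤ 2 / 3 := max_le (by linarith) (by norm_num)
          linarith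
      simp only [hG]
      rw [hr] at hd ⊢
      linarith
    · rw [slowness_of_not_disjoint hdis, edist_dist, ← ENNReal.ofReal_toReal hkt, ← hk,
        ← ENNReal.ofReal_mul hk0]
      apply ENNReal.ofReal_le_ofReal
      have := mul_le_mul_of_nonneg_left hd hk0
      have e0 := mul_le_mul_of_nonneg_right hk1 d0
      have e2 := mul_le_mul_of_nonneg_right hk1 d2
      simp only [hG]
      linarith

end Highway

/-! ### The walking region in coordinates and its boundary. -/

namespace Highway

open Filter Topology

variable {p v : ℝ≥0∞}

lemma mem_segment_feet_iff {q z : Plane p} (h : 0 ≤ q 1 * Real.tan (angle p v)) :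
    z ∈ segment ℝ (footLeft v q) (footRight v q) ↔
      z 1 = 0 ∧ |z 0 - q 0| ≤ q 1 * Real.tan (angle p v) := by
  have hseg := segment_eq_Icc (𝕜 := ℝ) (show q 0 - q 1 * Real.tan (angle p v) ≤
    q 0 + q 1 * Real.tan (angle p v) by linarith)
  constructor
  · rintro ⟨α, β, hα, hβ, hαβ, rfl⟩
    have hmem : α • (q 0 - q 1 * Real.tan (angle p v)) + β • (q 0 + q 1 * Real.tan (angle p v)) ∈
        segment ℝ (q 0 - q 1 * Real.tan (angle p v)) (q 0 + q 1 * Real.tan (angle p v)) :=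
      ⟨α, β, hα, hβ, hαβ, rfl⟩
    rw [hseg] at hmem
    refine ⟨by simp [footLeft, footRight], ?_⟩
    simp only [footLeft, footRight, PiLp.add_apply, PiLp.smul_apply, pt_zero]
    exact abs_le.2 ⟨by linarith [hmem.1], by linarith [hmem.2]⟩
  · rintro ⟨h1, h0⟩
    rw [abs_le] at h0
    have hmem : z 0 ∈ Icc (q 0 - q 1 * Real.tan (angle p v)) (q 0 + q 1 * Real.tan (angle p v)) :=
      ⟨by linarith, by linarith⟩
    rw [← hseg] at hmem
    obtain ⟨α, β, hα, hβ, hαβ, he⟩ := hmem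
    refine ⟨α, β, hα, hβ, hαβ, plane_ext ?_ ?_⟩
    · simpa [footLeft, footRight] using he
    · simp [footLeft, footRight, h1]

lemma exists_sign_mul_abs (d : ℝ) : ∃ σ : ℝ, |σ| = 1 ∧ d = σ * |d| := by
  rcases le_total 0 d with h | h
  · exact ⟨1, abs_one, by rw [abs_of_nonneg h, one_mul]⟩
  · exact ⟨-1, by simp, by rw [abs_of_nonpos h]; ring⟩

/-- Points of the bottom edge are limits of points straight above them, which stay in the tube
because its width is least at height `0`. -/
lemma closure_tube {ρ : ℝ → ℝ} (hρ : Continuous ρ) (hρ0 : ∀ y, 0 ≤ y → ρ 0 ≤ ρ y) (a : ℝ) :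
    closure {z : Plane p | 0 < z 1 ∧ |z 0 - a| ≤ ρ (z 1)} =
      {z | 0 ≤ z 1 ∧ |z 0 - a| ≤ ρ (z 1)} := by
  apply Subset.antisymm
  · refine closure_minimal (fun z hz => ⟨hz.1.le, hz.2⟩) ?_
    have c0 : Continuous fun z : Plane p => z 0 := by fun_prop
    have c1 : Continuous fun z : Plane p => z 1 := by fun_prop
    exact (isClosed_le continuous_const c1).inter
      (isClosed_le (c0.sub continuous_const).abs (hρ.comp c1))
  · rintro z ⟨h1, h0⟩
    rcases h1.eq_or_lt with h | h
    · have hc : Continuous fun ε : ℝ => pt p (z 0) ε :=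
        continuous_pt.comp (by fun_prop : Continuous fun ε : ℝ => (z 0, ε))
      have ht : Tendsto (fun ε : ℝ => pt p (z 0) ε) (𝓝[>] 0) (𝓝 z) := by
        have := hc.continuousWithinAt (s := Ioi 0) (x := 0)
        rwa [ContinuousWithinAt, show pt p (z 0) 0 = z from plane_ext rfl h] at this
      refine mem_closure_of_tendsto ht ?_
      filter_upwards [self_mem_nhdsWithin] with ε hε
      refine ⟨hε, ?_⟩
      rw [← h] at h0
      exact h0.trans (hρ0 ε (le_of_lt hε))
    · exact subset_closure ⟨h, h0⟩

lemma interior_tube {ρ : ℝ → ℝ} (hρ : Continuous ρ) (a : ℝ) :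
    interior {z : Plane p | 0 < z 1 ∧ |z 0 - a| ≤ ρ (z 1)} =
      {z | 0 < z 1 ∧ |z 0 - a| < ρ (z 1)} := by
  apply Subset.antisymm
  · intro z hz
    obtain ⟨h1, h0⟩ := interior_subset hz
    refine ⟨h1, lt_of_le_of_ne h0 fun heq => ?_⟩
    -- A point on a lateral side is a limit of points moved horizontally outwards, which leave the
    -- tube.
    obtain ⟨σ, hσ, hd⟩ := exists_sign_mul_abs (z 0 - a)
    have hc : Continuous fun ε : ℝ => pt p (z 0 + σ * ε) (z 1) :=
      continuous_pt.comp (by fun_prop : Continuous fun ε : ℝ => (z 0 + σ * ε, z 1))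
    have ht : Tendsto (fun ε : ℝ => pt p (z 0 + σ * ε) (z 1)) (𝓝[>] 0) (𝓝 z) := by
      have := hc.continuousWithinAt (s := Ioi 0) (x := 0)
      rwa [ContinuousWithinAt, mul_zero, add_zero, pt_coords] at this
    have hev := (ht.eventually (isOpen_interior.mem_nhds hz)).and self_mem_nhdsWithin
    obtain ⟨ε, hε, hε0⟩ := hev.exists
    have hε0 : 0 < ε := hε0
    have h2 := (interior_subset hε).2
    simp only [pt_zero, pt_one] at h2
    rw [← heq, show z 0 + σ * ε - a = σ * (|z 0 - a| + ε) by rw [mul_add, ← hd]; ring,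
      abs_mul, hσ, one_mul, abs_of_nonneg (by positivity)] at h2
    linarith
  · refine interior_maximal (fun z hz => ⟨hz.1, hz.2.le⟩) ?_
    have c0 : Continuous fun z : Plane p => z 0 := by fun_prop
    have c1 : Continuous fun z : Plane p => z 1 := by fun_prop
    exact (isOpen_lt continuous_const c1).inter
      (isOpen_lt (c0.sub continuous_const).abs (hρ.comp c1))

variable [hp : Fact (1 ≤ p)]

lemma norm_pt_sign_mul_left (t : ℝ) {σ s : ℝ} (hσ : |σ| = 1) (hs : 0 ≤ s) :
    ‖pt p (σ * (t * s)) s‖ = s * ‖pt p t 1‖ := by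
  rw [norm_pt_congr (p := p) (x' := t * s) (y' := s) (by rw [abs_mul, hσ, one_mul]) rfl,
    norm_pt_mul_left t hs]

lemma mem_rightCurve_iff {q z : Plane p} (hq : 0 ≤ q 1) :
    z ∈ rightCurve v q ↔ 0 ≤ z 1 ∧ Real.tan (angle p v) * q 1 ≤ z 0 - q 0 ∧
      ‖pt p (z 0 - q 0) (z 1 - q 1)‖ = q 1 * ‖pt p (Real.tan (angle p v)) 1‖ +
        z 1 * ‖pt p (Real.tan (angle p v)) 1‖ +
        (v⁻¹).toReal * |z 0 - q 0 - Real.tan (angle p v) * (q 1 + z 1)| := by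
  unfold rightCurve footRight footLeft
  generalize Real.tan (angle p v) = t at *
  refine and_congr_right fun hz => and_congr ?_ ?_
  · constructor <;> intro h <;> linarith
  · simp only [dist_eq_norm_pt, pt_zero, pt_one, sub_zero,
      norm_pt_zero_right]
    have e1 : ‖pt p (q 0 - z 0) (q 1 - z 1)‖ = ‖pt p (z 0 - q 0) (z 1 - q 1)‖ :=
      norm_pt_congr (abs_sub_comm _ _) (abs_sub_comm _ _)
    have e2 : ‖pt p (q 0 - (q 0 + q 1 * t)) (q 1)‖ = q 1 * ‖pt p t 1‖ := by
      rw [← norm_pt_mul_left t hq]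
      refine norm_pt_congr ?_ rfl
      rw [show q 0 - (q 0 + q 1 * t) = -(t * q 1) by ring, abs_neg]
    have e3 : ‖pt p (z 0 - (z 0 - z 1 * t)) (z 1)‖ = z 1 * ‖pt p t 1‖ := by
      rw [← norm_pt_mul_left t hz, show z 0 - (z 0 - z 1 * t) = t * z 1 by ring]
    have e4 : |q 0 + q 1 * t - (z 0 - z 1 * t)| = |z 0 - q 0 - t * (q 1 + z 1)| := by
      rw [abs_sub_comm]
      congr 1
      ring
    rw [e1, e2, e3, e4]

/-- The conditions on `r` are guarded by `0 ≤ z 1` because the root is specified only there, while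
points below the road must be decided too. -/
lemma mem_walkingRegion_iff (hv : 1 < v) {q z : Plane p} (hq : 0 < q 1) {t r : ℝ}
    (H : IsIncidence p (v⁻¹).toReal t) (hr : 0 ≤ z 1 → t * (q 1 + z 1) ≤ r)
    (hr' : 0 ≤ z 1 → ‖pt p r (z 1 - q 1)‖ =
      (q 1 + z 1) * (‖pt p t 1‖ - (v⁻¹).toReal * t) + (v⁻¹).toReal * r) :
    z ∈ walkingRegion v q ↔ 0 < z 1 ∧ |z 0 - q 0| ≤ r := by
  set k := (v⁻¹).toReal with hk
  constructor
  · rintro ⟨γ, hγ, hroad⟩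
    have hz : 0 < z 1 := by
      -- From a height at most `0`, a curve to `q` crosses the road by the intermediate value
      -- theorem.
      by_contra! hz
      have hc : Continuous fun s => γ s 1 := by
        have c1 : Continuous fun z : Plane p => z 1 := by fun_prop
        exact c1.comp γ.continuous
      obtain ⟨s, hs⟩ := mem_range_of_exists_le_of_exists_ge hc
        ⟨0, (by simpa using hz : γ 0 1 ≤ 0)⟩ ⟨1, (by simpa using hq.le : 0 ≤ γ 1 1)⟩
      exact hroad ⟨γ s, ⟨s, rfl⟩, hs⟩
    refine ⟨hz, ?_⟩
    by_contra! hlt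
    specialize hr hz.le
    specialize hr' hz.le
    obtain ⟨σ, hσ, hd⟩ := exists_sign_mul_abs (z 0 - q 0)
    have h1 := H.detour_lt_direct hq.le hz.le hr hr' hlt
    -- The competitor walks both legs at slope `t` towards each other; `σ` is the side of `q` on
    -- which `z` lies.
    have h2 := (edist_le_travelTime (v := v) γ hroad).trans ((hγ _).trans
      (travelTime_polygonalPath_le hv z q (z := pt p (z 0 - σ * (t * z 1)) 0)
        (w := pt p (q 0 + σ * (t * q 1)) 0) rfl rfl))
    rw [edist_dist, ENNReal.ofReal_le_ofReal_iff (by positivity)] at h2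
    simp only [dist_eq_norm_pt, pt_zero, pt_one, sub_zero, norm_pt_zero_right, sub_sub_cancel,
      add_sub_cancel_left, zero_sub] at h2
    rw [norm_pt_sign_mul_left t hσ hz.le,
      norm_pt_congr (p := p) (x := σ * (t * q 1)) (y := - q 1) (x' := σ * (t * q 1)) (y' := q 1)
        rfl (abs_neg _), norm_pt_sign_mul_left t hσ hq.le,
      show z 0 - σ * (t * z 1) - (q 0 + σ * (t * q 1)) = σ * (|z 0 - q 0| - t * (q 1 + z 1)) by
        rw [mul_sub, ← hd]; ring,
      abs_mul, hσ, one_mul, abs_of_nonneg (a := |z 0 - q 0| - t * (q 1 + z 1)) (by linarith)] at h2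
    linarith
  · rintro ⟨hz, hd⟩
    specialize hr hz.le
    specialize hr' hz.le
    refine ⟨Path.segment z q, fun γ => (travelTime_segment_le hv z q).trans ?_, ?_⟩
    · by_cases hroad : EntersRoad γ
      · obtain ⟨x, hx, w, hw, hle⟩ := exists_detour_le_travelTime hv
          (show z ∉ road p from hz.ne') (show q ∉ road p from hq.ne') γ hroad
        refine le_trans ?_ hle
        rw [edist_dist]
        apply ENNReal.ofReal_le_ofReal
        have hx' : x 1 = 0 := hx
        have hw' : w 1 = 0 := hw
        simp only [dist_eq_norm_pt, hx', hw', sub_zero, zero_sub, norm_pt_zero_right]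
        rw [norm_pt_congr (p := p) (x' := w 0 - q 0) (y' := q 1) rfl (abs_neg (q 1))]
        have := H.direct_le_detour (e := z 0 - x 0) (f := w 0 - q 0) hq.le hz.le hr hr' hd
        rwa [show z 0 - q 0 - (z 0 - x 0 + (w 0 - q 0)) = x 0 - w 0 by ring] at this
      · exact edist_le_travelTime γ hroad
    · rintro ⟨_, ⟨s, rfl⟩, hs⟩
      have hs : Path.segment z q s 1 = 0 := hs
      rw [Path.segment_apply, AffineMap.lineMap_apply_module] at hs
      simp only [PiLp.add_apply, PiLp.smul_apply, smul_eq_mul] at hs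
      have h0 : (0 : ℝ) ≤ s := s.2.1
      have h1 : (s : ℝ) ≤ 1 := s.2.2
      rcases h0.eq_or_lt with h | h
      · rw [← h] at hs
        linarith
      · nlinarith

end Highway

theorem mainTheorem6 (p v : ℝ≥0∞) [Fact (1 ≤ p)] (hv : 1 < v)
    (q : Highway.Plane p) (hq : 0 < q 1) :
    (∃ r : ℝ → ℝ, ContinuousOn r (Set.Ici 0) ∧
      Highway.rightCurve v q = {z | 0 ≤ z 1 ∧ z 0 = r (z 1)} ∧
      Highway.leftCurve v q = {z | 0 ≤ z 1 ∧ z 0 = 2 * q 0 - r (z 1)} ∧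
      Highway.walkingRegion v q =
        {z | 0 < z 1 ∧ 2 * q 0 - r (z 1) ≤ z 0 ∧ z 0 ≤ r (z 1)}) ∧
    frontier (Highway.walkingRegion v q) =
      Highway.leftCurve v q ∪ Highway.rightCurve v q ∪
        segment ℝ (Highway.footLeft v q) (Highway.footRight v q) ∧
    (p = ∞ →
      Highway.rightCurve v q = {z | 0 ≤ z 1 ∧ z 1 = z 0 - q 0 - q 1} ∧
      Highway.leftCurve v q = {z | 0 ≤ z 1 ∧ z 1 = q 0 - q 1 - z 0}) := by
  open Highway in
  have H := isIncidence_angle p v hv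
  obtain ⟨ρ, hρ, hρ0, hρ1, hρ2⟩ := H.exists_continuous_root hq.le
  have hR : rightCurve v q = {z | 0 ≤ z 1 ∧ z 0 = q 0 + ρ (z 1)} := by
    ext z
    rw [mem_rightCurve_iff hq.le]
    refine and_congr_right fun hz => ⟨fun h => ?_, fun h => ?_⟩
    · have := H.eq_root hq hz (hρ1 _ hz) (hρ2 _ hz) h.1 h.2
      linarith
    · have e : z 0 - q 0 = ρ (z 1) := by linarith
      have h1 := hρ1 _ hz
      rw [e]
      refine ⟨?_, ?_⟩
      · nlinarith [mul_nonneg H.slope_nonneg hz]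
      · rw [hρ2 _ hz, abs_of_nonneg (by linarith)]
        ring
  have hmirror : ∀ f : ℝ → ℝ, rightCurve v q = {z | 0 ≤ z 1 ∧ z 0 = f (z 1)} →
      leftCurve v q = {z | 0 ≤ z 1 ∧ z 0 = 2 * q 0 - f (z 1)} := by
    intro f hf
    ext z
    rw [leftCurve, hf]
    constructor
    · rintro ⟨w, ⟨hw1, hw0⟩, rfl⟩
      refine ⟨hw1, ?_⟩
      simp [mirror, hw0]
    · rintro ⟨h1, h0⟩
      refine ⟨mirror q z, ⟨h1, ?_⟩, plane_ext ?_ rfl⟩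
      · simp [mirror, h0]
      · simp [mirror]
  have hL := hmirror (fun y => q 0 + ρ y) hR
  have hW : walkingRegion v q = {z | 0 < z 1 ∧ |z 0 - q 0| ≤ ρ (z 1)} := by
    ext z
    exact mem_walkingRegion_iff hv hq H (hρ1 (z 1)) (hρ2 (z 1))
  have ht0 := H.slope_nonneg
  have hρ0le : ∀ y, 0 ≤ y → ρ 0 ≤ ρ y := by
    intro y hy
    rw [hρ0]
    nlinarith [hρ1 y hy, mul_nonneg ht0 hy]
  have hρpos : ∀ y, 0 ≤ y → 0 ≤ ρ y := fun y hy =>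
    (by rw [hρ0]; positivity : 0 ≤ ρ 0).trans (hρ0le y hy)
  refine ⟨⟨fun y => q 0 + ρ y, by fun_prop, hR, hL, ?_⟩, ?_, ?_⟩
  · rw [hW]
    ext z
    refine and_congr_right fun _ => ?_
    rw [abs_le]
    constructor <;> rintro ⟨h, h'⟩ <;> constructor <;> linarith
  · rw [frontier, hW, closure_tube hρ hρ0le, interior_tube hρ, hR, hL]
    ext z
    simp only [mem_sdiff, mem_union, mem_ofPred_eq,
      mem_segment_feet_iff (v := v) (q := q) (z := z) (by positivity)]
    constructor
    · rintro ⟨⟨h1, h0⟩, hn⟩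
      rcases h1.eq_or_lt with h | h
      · right
        rw [← h, hρ0, mul_comm] at h0
        exact ⟨h.symm, h0⟩
      · left
        have he : |z 0 - q 0| = ρ (z 1) := le_antisymm h0 (not_lt.1 fun h' => hn ⟨h, h'⟩)
        rcases abs_choice (z 0 - q 0) with h' | h'
        · right
          exact ⟨h1, by linarith⟩
        · left
          exact ⟨h1, by linarith⟩
    · rintro ((⟨h1, h0⟩ | ⟨h1, h0⟩) | ⟨h1, h0⟩)
      · have : |z 0 - q 0| = ρ (z 1) := by
          rw [h0, show 2 * q 0 - (q 0 + ρ (z 1)) - q 0 = -ρ (z 1) by ring, abs_neg,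
            abs_of_nonneg (hρpos _ h1)]
        exact ⟨⟨h1, this.le⟩, fun h => h.2.ne this⟩
      · have : |z 0 - q 0| = ρ (z 1) := by
          rw [h0, add_sub_cancel_left, abs_of_nonneg (hρpos _ h1)]
        exact ⟨⟨h1, this.le⟩, fun h => h.2.ne this⟩
      · rw [h1, hρ0, mul_comm]
        exact ⟨⟨le_rfl, h0⟩, fun h => lt_irrefl _ h.1⟩
  · rintro rfl
    have ht : Real.tan (angle ∞ v) = 1 := by simp [angle]
    have hlin : ∀ y, 0 ≤ y → ρ y = q 1 + y := by
      intro y hy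
      have hN : ‖pt ∞ (1 : ℝ) 1‖ = 1 := by simp [norm_pt_top]
      rw [ht] at H hρ1 hρ2
      -- At abscissa `q 1 + y` the two feet coincide, so the riding term vanishes and the equation
      -- reads `max (q 1 + y) |y - q 1| = q 1 + y`.
      refine (H.eq_root hq hy (hρ1 y hy) (hρ2 y hy) (by linarith) ?_).symm
      rw [hN, norm_pt_top, one_mul, sub_self, abs_zero, max_eq_left]
      · rw [abs_of_nonneg (by linarith)]
        ring
      · rw [abs_of_nonneg (a := q 1 + y) (by linarith)]
        exact abs_le.2 ⟨by linarith, by linarith⟩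
    rw [hR, hL]
    constructor
    all_goals
      ext z
      refine and_congr_right fun hz => ?_
      rw [hlin _ hz]
      constructor <;> intro h <;> linarith
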